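/- Let $d$ be a prime, $n\ge 0$ and $t\ge 1$ integers. Put $\tau=e^{\pi i(d^2+1)/d}$, $\omega=\tau^2=e^{2\pi i/d}$, and let $\mathcal H=(\mathbb C^d)^{\otimes n}$ have the product basis $\{|x\rangle : x\in\mathbb Z_d^n\}$. On $\mathbb C^d$ let $\hat x(q)|x\rangle=|x+q\rangle$, $\hat z(p)|x\rangle=\omega^{px}|x\rangle$ and $w(p,q)=\tau^{-pq}\hat z(p)\hat x(q)$, where the exponent of $\tau$ is computed in $\mathbb Z$ with $p,q\in\{0,\dots,d-1\}$. For $v=(p,q)\in V=\mathbb Z_d^n\times\mathbb Z_d^n$ let $w(v)=w(p_1,q_1)\otimes\cdots\otimes w(p_n,q_n)$. Let $[u,v]=u_p\cdot v_q-u_q\cdot v_p$ be the standard symplectic form on $V$; a subspace $M\subseteq V$ is Lagrangian if $M=\{v\in V: [v,m]=0\ \forall m\in M\}$. For a basis $\mathcal B=(u_1,\dots,u_r)$ of a Lagrangian $M$ and $m=\sum_i m_iu_i\in M$ let $w_{\mathcal B}(m)=\prod_i w(u_i)^{m_i}$. A stabilizer state is a unit vector $\psi\in\mathcal H$ such that,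 for some Lagrangian $M$, some basis $\mathcal B$ of $M$ and some $v\in V$, $\omega^{[v,m]}w_{\mathcal B}(m)\psi=\psi$ for all $m\in M$. Stabilizer states are identified if they differ by a global phase; let $\operatorname{Stabs}(d,n)\subset\mathcal H$ contain exactly one unit vector for each stabilizer state so identified (the phases being chosen arbitrarily). Then $\operatorname{Stabs}(d,n)$ is finite and non-empty and, with $S(d,n)=|\operatorname{Stabs}(d,n)|$, for every Lagrangian subspace $M\subseteq V$ the $t$-th frame potential $\mathcal F_t(\operatorname{Stabs}(d,n))=\mathbb E_{x,y}\,|\langle x,y\rangle|^{2t}$, where $x$ and $y$ are independent and uniformly distributed on $\operatorname{Stabs}(d,n)$, equals $$\mathcal F_t(\operatorname{Stabs}(d,n))=\frac1{S(d,n)}\sum_{k=0}^{n}\kappa_M(d,n,k)\,d^{(1-t)(n-k)},$$ where $\kappa_M(d,n,k)$ is the number of Lagrangian subspaces $N\subseteq V$ with $\dim(M\cap N)=k$. -/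

import Mathlib

open MeasureTheory ProbabilityTheory

namespace StabFrame

noncomputable section

/-- The phase `τ = exp(π i (d² + 1) / d)`. -/
def tau (d : ℕ) : ℂ := Complex.exp (Real.pi * Complex.I * ((d : ℂ) ^ 2 + 1) / d)

/-- The phase `ω = τ² = exp(2 π i / d)`. -/
def omega (d : ℕ) : ℂ := tau d ^ 2

/-- The configuration space `Q = ℤ_d^n`. -/
abbrev Config (d n : ℕ) : Type := Fin n → ZMod d

/-- The phase space `V = Q × Q`, with elements `(p, q)`. -/
abbrev PhaseSpace (d n : ℕ) : Type := Config d n × Config d n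

/-- The Hilbert space `(ℂ^d)^{⊗ n}`, with its product basis `|x⟩`, `x ∈ ℤ_d^n`. -/
abbrev Hilb (d n : ℕ) : Type := EuclideanSpace ℂ (Config d n)

/-- The standard symplectic form `[u, v] = u_p ⬝ v_q - u_q ⬝ v_p`. -/
def sympl {d n : ℕ} (u v : PhaseSpace d n) : ZMod d := u.1 ⬝ᵥ v.2 - u.2 ⬝ᵥ v.1

/-- `M` is Lagrangian: it equals its own symplectic complement. -/
def IsLagrangian {d n : ℕ} (M : Submodule (ZMod d) (PhaseSpace d n)) : Prop :=
  ∀ v : PhaseSpace d n, v ∈ M ↔ ∀ m ∈ M, sympl v m = 0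

/-- The shift `|x⟩ ↦ |x + q⟩` on `ℂ^d`. -/
def shift {d : ℕ} (q : ZMod d) : Matrix (ZMod d) (ZMod d) ℂ :=
  Matrix.of fun x y => if x = y + q then 1 else 0

/-- The boost `|x⟩ ↦ ω^{p x} |x⟩` on `ℂ^d`. -/
def boost {d : ℕ} (p : ZMod d) : Matrix (ZMod d) (ZMod d) ℂ :=
  Matrix.diagonal fun x => omega d ^ (p * x).val

/-- The Weyl operator `τ^{-pq} z(p) x(q)` on `ℂ^d`; the exponent of `τ` is computed in the integers
with the representatives of `p` and `q` in `{0, …, d - 1}`. -/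
def weylOne {d : ℕ} [NeZero d] (p q : ZMod d) : Matrix (ZMod d) (ZMod d) ℂ :=
  tau d ^ (-((p.val : ℤ) * (q.val : ℤ))) • (boost p * shift q)

/-- The Weyl operator `w(p₁, q₁) ⊗ ⋯ ⊗ w(pₙ, qₙ)` on `(ℂ^d)^{⊗ n}`, as a matrix in the product
basis. -/
def weyl {d n : ℕ} [NeZero d] (v : PhaseSpace d n) : Matrix (Config d n) (Config d n) ℂ :=
  Matrix.of fun x y => ∏ i, weylOne (v.1 i) (v.2 i) (x i) (y i)

/-- The basis-dependent Weyl operator `∏ᵢ w(uᵢ)^{mᵢ}`, where `m = ∑ᵢ mᵢ uᵢ` is the expansion of `m`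
in the basis `B = (u₁, …, u_r)` of `M`. -/
def weylB {d n r : ℕ} [NeZero d] {M : Submodule (ZMod d) (PhaseSpace d n)}
    (B : Module.Basis (Fin r) (ZMod d) M) (m : M) : Matrix (Config d n) (Config d n) ℂ :=
  (List.ofFn fun i => weyl (B i : PhaseSpace d n) ^ (B.repr m i).val).prod

/-- `ψ` is a stabilizer state vector `|M, v⟩`: a unit vector with `ω^{[v,m]} w_B(m) ψ = ψ` for all
`m ∈ M`, for some Lagrangian subspace `M`, some basis `B` of `M` and some `v ∈ V`. -/
def IsStabilizerState {d n : ℕ} [NeZero d] (ψ : Hilb d n) : Prop :=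
  ‖ψ‖ = 1 ∧ ∃ M : Submodule (ZMod d) (PhaseSpace d n), IsLagrangian M ∧
    ∃ (B : Module.Basis (Fin (Module.finrank (ZMod d) M)) (ZMod d) M) (v : PhaseSpace d n),
      ∀ m : M, omega d ^ (sympl v m).val • Matrix.toEuclideanLin (weylB B m) ψ = ψ

/-- `X` realizes the set `Stabs(d, n)`: stabilizer states are only defined up to a global phase, and
`X` contains exactly one unit vector for each of them. -/
structure IsStabs (d n : ℕ) [NeZero d] (X : Set (Hilb d n)) : Prop where
  isStabilizerState : ∀ x ∈ X, IsStabilizerState x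
  existsUnique_phase : ∀ ψ : Hilb d n, IsStabilizerState ψ →
    ∃! x, x ∈ X ∧ ∃ c : ℂ, ‖c‖ = 1 ∧ ψ = c • x

/-- The `t`-th frame potential `𝔼_{x, y ∼ μ} |⟨x, y⟩|^{2t}`, for `x` and `y` independent. -/
def framePotential {E : Type*} [NormedAddCommGroup E] [InnerProductSpace ℂ E] [MeasurableSpace E]
    (t : ℕ) (μ : Measure E) : ℝ :=
  ∫ x, ∫ y, ‖inner ℂ x y‖ ^ (2 * t) ∂μ ∂μ

/-- `κ_M(d, n, k)`: the number of Lagrangian subspaces `N` with `dim (M ∩ N) = k`. -/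
def kappa {d n : ℕ} (M : Submodule (ZMod d) (PhaseSpace d n)) (k : ℕ) : ℕ :=
  {N : Submodule (ZMod d) (PhaseSpace d n) |
    IsLagrangian N ∧ Module.finrank (ZMod d) (M ⊓ N : Submodule (ZMod d) (PhaseSpace d n)) = k}.ncard

/-- A choice of global phases exists. -/
theorem exists_isStabs (d n : ℕ) [NeZero d] : ∃ X : Set (Hilb d n), IsStabs d n X := by
  let s : Setoid {ψ : Hilb d n // IsStabilizerState ψ} :=
    { r := fun x y => ∃ c : ℂ, ‖c‖ = 1 ∧ (x : Hilb d n) = c • (y : Hilb d n)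
      iseqv :=
        { refl := fun x => ⟨1, by simp, by simp⟩
          symm := by
            rintro x y ⟨c, hc, h⟩
            have h0 : c ≠ 0 := by rintro rfl; simp at hc
            exact ⟨c⁻¹, by simp [hc], by rw [h, smul_smul, inv_mul_cancel₀ h0, one_smul]⟩
          trans := by
            rintro x y z ⟨c, hc, h⟩ ⟨e, he, h'⟩
            exact ⟨c * e, by simp [hc, he], by rw [h, h', smul_smul]⟩ } }
  refine ⟨Set.range fun a : Quotient s => (a.out : Hilb d n), ?_, ?_⟩
  · rintro _ ⟨a, rfl⟩
    exact a.out.2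
  · intro ψ hψ
    refine ⟨((Quotient.mk s ⟨ψ, hψ⟩).out : Hilb d n), ⟨⟨_, rfl⟩, ?_⟩, ?_⟩
    · exact s.symm (Quotient.mk_out (s := s) ⟨ψ, hψ⟩)
    · rintro _ ⟨⟨a, rfl⟩, h⟩
      have : Quotient.mk s ⟨ψ, hψ⟩ = Quotient.mk s a.out := Quotient.sound (s := s) h
      rw [this, Quotient.out_eq]

end

end StabFrame

/-!
A stabilizer state `y` of a Lagrangian subspace `N` is fixed by a family of unitary operators
`U(m)`, `m ∈ N`, that is multiplicative in `m` and agrees with the Weyl operators `w(m)` up to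
phases (`IsWeylLift`). The average `|N|⁻¹ ∑ₘ U(m)` is a projection, and it has trace one because
`N` has `dⁿ` elements and all Weyl operators but the identity are traceless; so it is `|y⟩⟨y|`
(`IsWeylLift.liftAverage_eq_inner_smul`). Therefore the stabilizer states of `N`, taken up to phase,
form an orthonormal basis: different joint eigenvalues of the unitaries `w(m)` give orthogonal
states, and the projections for the various twists `ω^{[v, m]} w_B(m)` add up to a multiple of the
identity (`eq_zero_of_forall_inner_stabilizerState_eq_zero`).

Let `x` be a stabilizer state of `M` and put `k = dim (M ⊓ N)`. In `|⟨x, y⟩|² = ⟨x, |y⟩⟨y| x⟩`, which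
is the average of `⟨x, U(m) x⟩` over `N`, only the `m ∈ M ⊓ N` contribute, and their contributions
form a character; so `|⟨x, y⟩|²` is `0` or `d ^ (k - n)` (`StabilizedBy.norm_inner_sq`). There is no
need to count the nonzero overlaps: by Parseval's identity the sum of `|⟨x, y⟩|²` over the states `y`
of `N` is `1`, so the sum of `|⟨x, y⟩|^{2t}` is `d ^ ((1 - t) (n - k))`
(`IsStabs.sum_norm_inner_pow`).

A stabilizer state determines its Lagrangian subspace (`StabilizedBy.unique`), so summing over `N`
gives `∑ₖ κ_M(d, n, k) d ^ ((1 - t) (n - k))` for each `x`. This does not depend on the subspace `M`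
of `x`, because symplectic transvections act transitively on Lagrangian subspaces
(`IsLagrangian.exists_map_eq`).
-/

namespace StabFrame

variable {d n : ℕ}

/-! ### Symplectic geometry of the phase space -/

/-- The symplectic form as a bilinear form. -/
def symplForm (d n : ℕ) : LinearMap.BilinForm (ZMod d) (PhaseSpace d n) :=
  LinearMap.mk₂ (ZMod d) sympl
    (fun u u' v => by simp [sympl, add_dotProduct]; ring)
    (fun c u v => by simp [sympl, smul_dotProduct, mul_sub])
    (fun u v v' => by simp [sympl, dotProduct_add]; ring)
    (fun c u v => by simp [sympl, dotProduct_smul, mul_sub])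

@[simp]
lemma symplForm_apply (u v : PhaseSpace d n) : symplForm d n u v = sympl u v := rfl

lemma sympl_add_left (u u' v : PhaseSpace d n) : sympl (u + u') v = sympl u v + sympl u' v :=
  LinearMap.map_add₂ (symplForm d n) u u' v

lemma sympl_add_right (u v v' : PhaseSpace d n) : sympl u (v + v') = sympl u v + sympl u v' :=
  map_add (symplForm d n u) v v'

lemma sympl_sub_right (u v v' : PhaseSpace d n) : sympl u (v - v') = sympl u v - sympl u v' :=
  map_sub (symplForm d n u) v v'

lemma sympl_smul_left (c : ZMod d) (u v : PhaseSpace d n) : sympl (c • u) v = c * sympl u v :=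
  LinearMap.map_smul₂ (symplForm d n) c u v

lemma sympl_smul_right (c : ZMod d) (u v : PhaseSpace d n) : sympl u (c • v) = c * sympl u v :=
  map_smul (symplForm d n u) c v

@[simp]
lemma sympl_zero_right (u : PhaseSpace d n) : sympl u 0 = 0 :=
  map_zero (symplForm d n u)

@[simp]
lemma sympl_self (u : PhaseSpace d n) : sympl u u = 0 := by
  simp [sympl, dotProduct_comm u.2 u.1]

lemma sympl_swap (u v : PhaseSpace d n) : sympl u v = -sympl v u := by
  simp [sympl, dotProduct_comm u.2 v.1, dotProduct_comm u.1 v.2]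

lemma eq_zero_of_forall_sympl_eq_zero {v : PhaseSpace d n} (h : ∀ u, sympl u v = 0) : v = 0 := by
  ext i
  · simpa [sympl] using h (0, Pi.single i 1)
  · simpa [sympl] using h (Pi.single i 1, 0)

lemma symplForm_nondegenerate : (symplForm d n).Nondegenerate := by
  refine ⟨fun v hv => ?_, fun v hv => ?_⟩
  · exact eq_zero_of_forall_sympl_eq_zero fun u => by
      rw [sympl_swap, ← symplForm_apply, hv, neg_zero]
  · exact eq_zero_of_forall_sympl_eq_zero hv

/-- The subspace of all momenta `(p, 0)` is Lagrangian. -/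
lemma isLagrangian_prod_top_bot :
    IsLagrangian (Submodule.prod ⊤ ⊥ : Submodule (ZMod d) (PhaseSpace d n)) := by
  intro v
  constructor
  · rintro hv m hm
    simp only [Submodule.mem_prod, Submodule.mem_bot, Submodule.mem_top, true_and] at hv hm
    simp [sympl, hv, hm]
  · intro h
    simp only [Submodule.mem_prod, Submodule.mem_bot, Submodule.mem_top, true_and]
    ext i
    simpa [sympl] using h (Pi.single i 1, 0) (by simp)

lemma IsLagrangian.eq_of_le {M N : Submodule (ZMod d) (PhaseSpace d n)} (hM : IsLagrangian M)
    (hN : IsLagrangian N) (h : M ≤ N) : M = N :=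
  le_antisymm h fun v hv => (hM v).2 fun m hm => (hN v).1 hv m (h hm)

section Transitivity

variable [Fact d.Prime]

lemma IsLagrangian.finrank_eq {M : Submodule (ZMod d) (PhaseSpace d n)} (hM : IsLagrangian M) :
    Module.finrank (ZMod d) M = n := by
  have h := LinearMap.BilinForm.finrank_orthogonal (symplForm_nondegenerate (d := d) (n := n)) M
  have hperp : (symplForm d n).orthogonal M = M := by
    ext v
    rw [LinearMap.BilinForm.mem_orthogonal_iff, hM v]
    refine forall₂_congr fun m _ => ?_
    rw [symplForm_apply, sympl_swap, neg_eq_zero]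
  have hle := Submodule.finrank_le M
  rw [hperp] at h
  simp only [Module.finrank_prod, Module.finrank_fin_fun] at h hle
  omega

lemma IsLagrangian.natCard_eq {M : Submodule (ZMod d) (PhaseSpace d n)} (hM : IsLagrangian M) :
    Nat.card M = d ^ n := by
  rw [Module.natCard_eq_pow_finrank (K := ZMod d), hM.finrank_eq, Nat.card_zmod]

/-- The symplectic transvection `x ↦ x + c [x, w] w`. -/
def symplTransvection (c : ZMod d) (w : PhaseSpace d n) :
    PhaseSpace d n ≃ₗ[ZMod d] PhaseSpace d n where
  toFun x := x + (c * sympl x w) • w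
  invFun x := x - (c * sympl x w) • w
  map_add' x y := by
    rw [sympl_add_left, mul_add, add_smul]; abel
  map_smul' a x := by
    rw [sympl_smul_left, RingHom.id_apply, smul_add, smul_smul, mul_left_comm]
  left_inv x := by simp [sympl_add_left, sympl_smul_left]
  right_inv x := by
    simp only [sub_eq_add_neg, ← neg_smul, sympl_add_left, sympl_smul_left, sympl_self]
    simp

lemma symplTransvection_apply (c : ZMod d) (w x : PhaseSpace d n) :
    symplTransvection c w x = x + (c * sympl x w) • w := rfl

lemma sympl_symplTransvection (c : ZMod d) (w x y : PhaseSpace d n) :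
    sympl (symplTransvection c w x) (symplTransvection c w y) = sympl x y := by
  simp only [symplTransvection_apply, sympl_add_left, sympl_add_right, sympl_smul_left,
    sympl_smul_right, sympl_self, sympl_swap w y]
  ring

lemma IsLagrangian.map {M : Submodule (ZMod d) (PhaseSpace d n)} (hM : IsLagrangian M)
    {g : PhaseSpace d n ≃ₗ[ZMod d] PhaseSpace d n} (hg : ∀ x y, sympl (g x) (g y) = sympl x y) :
    IsLagrangian (M.map (g : PhaseSpace d n →ₗ[ZMod d] PhaseSpace d n)) := by
  intro v
  obtain ⟨u, rfl⟩ := g.surjective v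
  rw [Submodule.mem_map_equiv, LinearEquiv.symm_apply_apply, hM u]
  constructor
  · rintro h _ ⟨m, hm, rfl⟩
    exact (hg u m).trans (h m hm)
  · exact fun h m hm => (hg u m).symm.trans (h _ ⟨m, hm, rfl⟩)

/-- The symplectic group acts transitively on Lagrangian subspaces. If `u ∈ M` and `v ∈ M'` satisfy
`[u, v] ≠ 0`, the transvection along `v - u` that sends `u` to `v` fixes `M ⊓ M'` pointwise, so it
enlarges the intersection with `M'`. -/
lemma IsLagrangian.exists_map_eq {M M' : Submodule (ZMod d) (PhaseSpace d n)}
    (hM : IsLagrangian M) (hM' : IsLagrangian M') :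
    ∃ g : PhaseSpace d n ≃ₗ[ZMod d] PhaseSpace d n, (∀ x y, sympl (g x) (g y) = sympl x y) ∧
      M.map (g : PhaseSpace d n →ₗ[ZMod d] PhaseSpace d n) = M' := by
  induction hk : n - Module.finrank (ZMod d) (M ⊓ M' : Submodule (ZMod d) (PhaseSpace d n))
    using Nat.strong_induction_on generalizing M with
  | _ k ih =>
    by_cases hle : M' ≤ M
    · refine ⟨LinearEquiv.refl _ _, fun _ _ => rfl, ?_⟩
      rw [hM'.eq_of_le hM hle]
      exact Submodule.map_id M
    obtain ⟨v, hv, hvM⟩ := SetLike.not_le_iff_exists.1 hle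
    obtain ⟨u, hu, huv⟩ : ∃ u ∈ M, sympl v u ≠ 0 := by
      by_contra! h
      exact hvM ((hM v).2 h)
    have huv' : sympl u v ≠ 0 := by rwa [sympl_swap, neg_ne_zero]
    set T := symplTransvection (sympl u v)⁻¹ (v - u) with hT
    have hTs : ∀ x y, sympl (T x) (T y) = sympl x y := sympl_symplTransvection _ _
    have hTu : T u = v := by
      simp [hT, symplTransvection_apply, sympl_sub_right, inv_mul_cancel₀ huv']
    have hTfix : ∀ x ∈ M ⊓ M', T x = x := by
      intro x hx
      simp [hT, symplTransvection_apply, sympl_sub_right, (hM x).1 hx.1 u hu,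
        (hM' x).1 hx.2 v hv]
    have hlt : M ⊓ M' < M.map (T : PhaseSpace d n →ₗ[ZMod d] PhaseSpace d n) ⊓ M' := by
      refine lt_of_le_of_ne (fun x hx => ⟨⟨x, hx.1, hTfix x hx⟩, hx.2⟩) fun h => hvM ?_
      have hvT : v ∈ M.map (T : PhaseSpace d n →ₗ[ZMod d] PhaseSpace d n) ⊓ M' :=
        ⟨⟨u, hu, hTu⟩, hv⟩
      exact (h ▸ hvT : v ∈ M ⊓ M').1
    have hrank := Submodule.finrank_lt_finrank_of_lt hlt
    have hrank' := (Submodule.finrank_mono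
      (inf_le_right : M.map (T : PhaseSpace d n →ₗ[ZMod d] PhaseSpace d n) ⊓ M' ≤ M'))
    rw [hM'.finrank_eq] at hrank'
    obtain ⟨g, hg, hgM⟩ := ih _ (by omega) (hM.map hTs) rfl
    refine ⟨T.trans g, fun x y => by simp [hg, hTs], ?_⟩
    rw [LinearEquiv.coe_trans, Submodule.map_comp, hgM]

/-- By transitivity, `κ_M` does not depend on the Lagrangian subspace `M`. -/
lemma kappa_eq_kappa {M M' : Submodule (ZMod d) (PhaseSpace d n)} (hM : IsLagrangian M)
    (hM' : IsLagrangian M') (k : ℕ) : kappa M k = kappa M' k := by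
  have key : ∀ {M M' : Submodule (ZMod d) (PhaseSpace d n)}, IsLagrangian M → IsLagrangian M' →
      kappa M k ≤ kappa M' k := by
    intro M M' hM hM'
    obtain ⟨g, hg, rfl⟩ := hM.exists_map_eq hM'
    refine Set.ncard_le_ncard_of_injOn
      (fun N => N.map (g : PhaseSpace d n →ₗ[ZMod d] PhaseSpace d n)) ?_
      (Submodule.map_injective_of_injective g.injective).injOn (Set.toFinite _)
    rintro N ⟨hN, hk⟩
    refine ⟨hN.map hg, ?_⟩
    rw [← Submodule.map_inf _ g.injective, ← hk]
    exact LinearEquiv.finrank_map_eq g _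
  exact le_antisymm (key hM hM') (key hM' hM)

end Transitivity

/-! ### Weyl operators -/

lemma tau_ne_zero : tau d ≠ 0 := Complex.exp_ne_zero _

lemma norm_tau : ‖tau d‖ = 1 := by
  have h : Real.pi * Complex.I * ((d : ℂ) ^ 2 + 1) / d
      = ((Real.pi * ((d : ℝ) ^ 2 + 1) / d : ℝ) : ℂ) * Complex.I := by
    push_cast; ring
  rw [tau, h, Complex.norm_exp_ofReal_mul_I]

section Phases

variable [NeZero d]

/-- `τ` is a root of unity of order dividing `d²`, because `d (d² + 1)` is even. -/
lemma tau_pow_sq : tau d ^ (d ^ 2) = 1 := by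
  have hd : (d : ℂ) ≠ 0 := Nat.cast_ne_zero.2 (NeZero.ne d)
  obtain ⟨k, hk⟩ : Even (d * (d ^ 2 + 1)) := by
    rcases Nat.even_or_odd d with h | h
    · exact h.mul_right _
    · exact (h.pow.add_odd odd_one).mul_left _
  have hk' : (d : ℂ) * (d ^ 2 + 1) = k + k := by exact_mod_cast congrArg (Nat.cast (R := ℂ)) hk
  rw [tau, ← Complex.exp_nat_mul, Complex.exp_eq_one_iff]
  refine ⟨k, ?_⟩
  push_cast
  field_simp
  linear_combination hk'

lemma omega_zpow (j : ℤ) : omega d ^ j = ZMod.stdAddChar (j : ZMod d) := by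
  have hd : (d : ℂ) ≠ 0 := Nat.cast_ne_zero.2 (NeZero.ne d)
  rw [ZMod.stdAddChar_coe, omega, tau, ← Complex.exp_nat_mul, ← Complex.exp_int_mul,
    Complex.exp_eq_exp_iff_exists_int]
  refine ⟨j * d, ?_⟩
  push_cast
  field_simp
  ring

lemma omega_pow_val (a : ZMod d) : omega d ^ a.val = ZMod.stdAddChar a := by
  rw [← zpow_natCast, omega_zpow, Int.cast_natCast, ZMod.natCast_zmod_val]

@[simp]
lemma norm_stdAddChar (a : ZMod d) : ‖(ZMod.stdAddChar a : ℂ)‖ = 1 := by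
  rw [ZMod.stdAddChar_apply, Circle.norm_coe]

/-- The Weyl operator without its phase: `|y⟩ ↦ ω^{p · (y + q)} |y + q⟩` for `v = (p, q)`. -/
noncomputable def weylPlain (v : PhaseSpace d n) : Matrix (Config d n) (Config d n) ℂ :=
  Matrix.of fun x y => if x = y + v.2 then ZMod.stdAddChar (v.1 ⬝ᵥ x) else 0

/-- The phase relating `weyl v` to `weylPlain v`. -/
noncomputable def weylPhase (v : PhaseSpace d n) : ℂ :=
  tau d ^ (-∑ i, ((v.1 i).val : ℤ) * ((v.2 i).val : ℤ))

omit [NeZero d] in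
lemma norm_weylPhase (v : PhaseSpace d n) : ‖weylPhase v‖ = 1 := by
  rw [weylPhase, norm_zpow, norm_tau, one_zpow]

lemma stdAddChar_sum {ι : Type*} (s : Finset ι) (f : ι → ZMod d) :
    (ZMod.stdAddChar (∑ i ∈ s, f i) : ℂ) = ∏ i ∈ s, ZMod.stdAddChar (f i) :=
  map_sum (ZMod.stdAddChar (N := d)).toAddMonoidHom f s

lemma weyl_eq_smul (v : PhaseSpace d n) : weyl v = weylPhase v • weylPlain v := by
  ext x y
  have hphase : weylPhase v = ∏ i, tau d ^ (-(((v.1 i).val : ℤ) * ((v.2 i).val : ℤ))) := by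
    rw [weylPhase, ← Finset.sum_neg_distrib]
    induction (Finset.univ : Finset (Fin n)) using Finset.cons_induction with
    | empty => simp
    | cons i s hi ih => rw [Finset.sum_cons, Finset.prod_cons, zpow_add₀ tau_ne_zero, ih]
  have hind : (if x = y + v.2 then (1 : ℂ) else 0) = ∏ i, if x i = y i + v.2 i then 1 else 0 := by
    rw [Finset.prod_ite_zero]
    simp [funext_iff]
  have hplain : weylPlain v x y
      = ∏ i, (ZMod.stdAddChar (v.1 i * x i) * if x i = y i + v.2 i then 1 else 0 : ℂ) := by
    rw [Finset.prod_mul_distrib, ← hind, ← stdAddChar_sum, weylPlain, Matrix.of_apply, mul_ite,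
      mul_one, mul_zero, dotProduct]
  rw [Matrix.smul_apply, smul_eq_mul, hplain, hphase, ← Finset.prod_mul_distrib, weyl,
    Matrix.of_apply]
  refine Finset.prod_congr rfl fun i _ => ?_
  rw [weylOne, Matrix.smul_apply, smul_eq_mul, boost, Matrix.diagonal_mul, shift, Matrix.of_apply,
    omega_pow_val]

@[simp]
lemma weylPlain_zero : weylPlain (0 : PhaseSpace d n) = 1 := by
  ext x y
  simp [weylPlain, Matrix.one_apply]

lemma weylPlain_mul (u v : PhaseSpace d n) :
    weylPlain u * weylPlain v = (ZMod.stdAddChar (-(v.1 ⬝ᵥ u.2)) : ℂ) • weylPlain (u + v) := by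
  ext x z
  rw [Matrix.mul_apply, Finset.sum_eq_single (z + v.2)]
  · by_cases h : x = z + v.2 + u.2
    · have h' : x = z + (u + v).2 := by rw [h, Prod.snd_add]; abel
      simp only [weylPlain, Matrix.of_apply, Matrix.smul_apply, if_pos h, if_pos h', if_pos,
        smul_eq_mul, ← AddChar.map_add_eq_mul]
      congr 1
      rw [h]
      simp only [Prod.fst_add, add_dotProduct, dotProduct_add]
      ring
    · have h' : ¬ x = z + (u + v).2 := by
        rintro rfl
        exact h (by rw [Prod.snd_add]; abel)
      simp only [weylPlain, Matrix.of_apply, Matrix.smul_apply, if_neg h, if_neg h', smul_zero]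
      simp
  · intro y _ hy
    simp [weylPlain, hy]
  · simp

/-- The commutation relation `w(u) w(v) = ω^{[u, v]} w(v) w(u)`. -/
lemma weylPlain_mul_comm (u v : PhaseSpace d n) :
    weylPlain u * weylPlain v
      = (ZMod.stdAddChar (sympl u v) : ℂ) • (weylPlain v * weylPlain u) := by
  rw [weylPlain_mul, weylPlain_mul, smul_smul, ← AddChar.map_add_eq_mul, add_comm v u, sympl,
    dotProduct_comm v.1 u.2]
  congr 2
  ring

lemma weylPlain_pow (v : PhaseSpace d n) (k : ℕ) :
    weylPlain v ^ k
      = (ZMod.stdAddChar (-((k.choose 2 : ZMod d) * (v.1 ⬝ᵥ v.2))) : ℂ) • weylPlain (k • v) := by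
  induction k with
  | zero => simp
  | succ k ih =>
    rw [pow_succ, ih, smul_mul_assoc, weylPlain_mul, smul_smul, ← AddChar.map_add_eq_mul,
      ← succ_nsmul]
    congr 2
    rw [Nat.choose_succ_succ' k 1, Nat.choose_one_right, Prod.smul_snd, dotProduct_smul,
      nsmul_eq_mul]
    push_cast
    ring

/-- The phases are chosen such that `w(v) ^ d = 1` for odd and for even `d`. -/
lemma weyl_pow_card (v : PhaseSpace d n) : weyl v ^ d = 1 := by
  set s : ℤ := ∑ i, ((v.1 i).val : ℤ) * ((v.2 i).val : ℤ) with hs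
  have hcast : v.1 ⬝ᵥ v.2 = ((s : ℤ) : ZMod d) := by
    simp [hs, dotProduct]
  have hchar : (ZMod.stdAddChar (-((d.choose 2 : ZMod d) * (v.1 ⬝ᵥ v.2))) : ℂ)
      = tau d ^ (-(2 * (d.choose 2 : ℤ) * s)) := by
    have : -((d.choose 2 : ZMod d) * (v.1 ⬝ᵥ v.2)) = ((-((d.choose 2 : ℤ) * s) : ℤ) : ZMod d) := by
      rw [hcast]; push_cast; ring
    rw [this, ← omega_zpow, omega, ← zpow_natCast, ← zpow_mul]
    congr 1
    push_cast
    ring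
  have hchoose : (2 * (d.choose 2 : ℤ)) = d * (d - 1) := by
    have h2 : d.choose 2 * 2 = d * (d - 1) := by
      rw [Nat.choose_two_right]
      exact Nat.div_mul_cancel (Nat.even_mul_pred_self d).two_dvd
    have h3 : ((d - 1 : ℕ) : ℤ) = d - 1 := by
      rw [Nat.cast_sub (NeZero.one_le), Nat.cast_one]
    rw [← h3]
    exact_mod_cast (mul_comm _ _).trans h2
  have hdv : d • v = 0 := by
    rw [← Nat.cast_smul_eq_nsmul (ZMod d), ZMod.natCast_self, zero_smul]
  rw [weyl_eq_smul, smul_pow, weylPlain_pow, hdv, weylPlain_zero, smul_smul, hchar, weylPhase,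
    ← zpow_natCast, ← zpow_mul, ← zpow_add₀ tau_ne_zero]
  -- The exponent of `τ` is a multiple of `d²`, whatever the parity of `d`.
  have hexp : -s * (d : ℤ) + -(2 * (d.choose 2 : ℤ) * s) = ((d ^ 2 : ℕ) : ℤ) * (-s) := by
    rw [hchoose]; push_cast; ring
  rw [hexp, zpow_mul, zpow_natCast, tau_pow_sq, one_zpow, one_smul]

lemma weylPlain_trace [Fact d.Prime] {v : PhaseSpace d n} (hv : v ≠ 0) :
    (weylPlain v).trace = 0 := by
  by_cases hq : v.2 = 0
  · have hp : v.1 ≠ 0 := fun hp => hv (Prod.ext hp hq)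
    obtain ⟨i, hi⟩ := Function.ne_iff.1 hp
    let ψ : AddChar (Config d n) ℂ :=
      ZMod.stdAddChar.compAddMonoidHom (dotProductBilin (ZMod d) (ZMod d) v.1).toAddMonoidHom
    have hψ : ψ ≠ 0 := by
      intro h
      have h1 : ψ (Pi.single i 1) = 1 := by rw [h]; rfl
      have h2 : (ZMod.stdAddChar (v.1 i) : ℂ) = ZMod.stdAddChar (0 : ZMod d) := by
        rw [AddChar.map_zero_eq_one, ← h1]
        simp [ψ]
      exact hi (ZMod.injective_stdAddChar h2)
    have h := AddChar.sum_eq_zero_iff_ne_zero.2 hψ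
    simpa [Matrix.trace, weylPlain, hq, ψ] using h
  · refine Finset.sum_eq_zero fun x _ => ?_
    simp [weylPlain, hq]

lemma conjTranspose_weylPlain_mul_self (v : PhaseSpace d n) :
    (weylPlain v).conjTranspose * weylPlain v = 1 := by
  ext x z
  rw [Matrix.mul_apply, Finset.sum_eq_single (x + v.2)]
  · by_cases h : x = z
    · simp [weylPlain, ← h, Complex.conj_mul', Matrix.one_apply]
    · simp [weylPlain, h]
  · intro y _ hy
    simp [weylPlain, hy]
  · simp

end Phases

/-! ### Commuting families of Weyl operators -/

section Lifts

variable [NeZero d]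

/-- A lift of the subspace `M` to the Heisenberg–Weyl group: a choice of a phase for each Weyl
operator `w(m)`, `m ∈ M`, that makes it multiplicative. -/
structure IsWeylLift (M : Submodule (ZMod d) (PhaseSpace d n))
    (U : M → Matrix (Config d n) (Config d n) ℂ) : Prop where
  map_add : ∀ m m', U (m + m') = U m * U m'
  exists_phase : ∀ m, ∃ c : ℂ, ‖c‖ = 1 ∧ U m = c • weylPlain (m : PhaseSpace d n)

lemma prod_ofFn_mul_of_commute {R : Type*} [Monoid R] {r : ℕ} (f g : Fin r → R)
    (h : ∀ i j, Commute (f i) (g j)) :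
    (List.ofFn fun i => f i * g i).prod = (List.ofFn f).prod * (List.ofFn g).prod := by
  induction r with
  | zero => simp
  | succ r ih =>
    have hc : Commute (g 0) (List.ofFn fun i : Fin r => f i.succ).prod := by
      refine Commute.list_prod_right _ _ fun x hx => ?_
      obtain ⟨i, rfl⟩ := List.mem_ofFn.1 hx
      exact (h i.succ 0).symm
    simp only [List.ofFn_succ, List.prod_cons]
    rw [ih (fun i => f i.succ) (fun i => g i.succ) fun i j => h _ _, mul_assoc, mul_assoc,
      ← mul_assoc (g 0), hc.eq, mul_assoc]

lemma exists_phase_pow {A : Matrix (Config d n) (Config d n) ℂ} {v : PhaseSpace d n}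
    (h : ∃ c : ℂ, ‖c‖ = 1 ∧ A = c • weylPlain v) (k : ℕ) :
    ∃ c : ℂ, ‖c‖ = 1 ∧ A ^ k = c • weylPlain (k • v) := by
  obtain ⟨c, hc, rfl⟩ := h
  refine ⟨_, ?_, by rw [smul_pow, weylPlain_pow, smul_smul]⟩
  simp [hc]

lemma exists_phase_prod_ofFn {r : ℕ} (A : Fin r → Matrix (Config d n) (Config d n) ℂ)
    (v : Fin r → PhaseSpace d n) (h : ∀ i, ∃ c : ℂ, ‖c‖ = 1 ∧ A i = c • weylPlain (v i)) :
    ∃ c : ℂ, ‖c‖ = 1 ∧ (List.ofFn A).prod = c • weylPlain (∑ i, v i) := by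
  induction r with
  | zero => exact ⟨1, by simp, by simp⟩
  | succ r ih =>
    obtain ⟨c, hc, h1⟩ := ih (fun i => A i.succ) (fun i => v i.succ) fun i => h _
    obtain ⟨c', hc', h2⟩ := h 0
    refine ⟨c' * (c * ZMod.stdAddChar (-((∑ i : Fin r, v i.succ).1 ⬝ᵥ (v 0).2))),
      by simp [hc, hc'], ?_⟩
    rw [List.ofFn_succ, List.prod_cons, h1, h2, smul_mul_smul_comm, weylPlain_mul, smul_smul,
      Fin.sum_univ_succ, mul_assoc]

/-- The operators `w_B(m)` form a lift of `M`: the `w(uᵢ)` commute because `M` is isotropic, and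
their exponents matter only modulo `d` because `w(uᵢ) ^ d = 1`. -/
lemma isWeylLift_weylB {M : Submodule (ZMod d) (PhaseSpace d n)} (hM : IsLagrangian M) {r : ℕ}
    (B : Module.Basis (Fin r) (ZMod d) M) : IsWeylLift M (weylB B) := by
  have hcomm : ∀ i j, Commute (weyl (B i : PhaseSpace d n)) (weyl (B j : PhaseSpace d n)) := by
    intro i j
    have h := weylPlain_mul_comm (B i : PhaseSpace d n) (B j : PhaseSpace d n)
    rw [(hM _).1 (B i).2 _ (B j).2, AddChar.map_zero_eq_one, one_smul] at h
    rw [weyl_eq_smul, weyl_eq_smul]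
    exact ((show Commute _ _ from h).smul_left _).smul_right _
  refine ⟨fun m m' => ?_, fun m => ?_⟩
  · rw [weylB, weylB, weylB,
      ← prod_ofFn_mul_of_commute _ _ fun i j => (hcomm i j).pow_pow _ _]
    congr 2
    funext i
    rw [← pow_add, map_add, Finsupp.add_apply, ZMod.val_add]
    exact (pow_eq_pow_mod _ (weyl_pow_card _)).symm
  · obtain ⟨c, hc, h⟩ := exists_phase_prod_ofFn
      (fun i => weyl (B i : PhaseSpace d n) ^ (B.repr m i).val)
      (fun i => (B.repr m i).val • (B i : PhaseSpace d n))
      fun i => exists_phase_pow ⟨_, norm_weylPhase _, weyl_eq_smul _⟩ _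
    refine ⟨c, hc, ?_⟩
    have hm : ∑ i, (B.repr m i).val • (B i : PhaseSpace d n) = m := by
      conv_rhs => rw [← B.sum_repr m]
      rw [Submodule.coe_sum]
      refine Finset.sum_congr rfl fun i _ => ?_
      rw [Submodule.coe_smul, ← Nat.cast_smul_eq_nsmul (ZMod d), ZMod.natCast_zmod_val]
    rw [weylB, h, hm]

namespace IsWeylLift

variable {M : Submodule (ZMod d) (PhaseSpace d n)} {U : M → Matrix (Config d n) (Config d n) ℂ}

/-- Twisting a lift by the character `m ↦ ω^{[v, m]}` gives another lift. -/
lemma twist (hU : IsWeylLift M U) (v : PhaseSpace d n) :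
    IsWeylLift M fun m => (ZMod.stdAddChar (sympl v m) : ℂ) • U m := by
  refine ⟨fun m m' => ?_, fun m => ?_⟩
  · rw [hU.map_add, Submodule.coe_add, sympl_add_right, AddChar.map_add_eq_mul, smul_mul_smul_comm]
  · obtain ⟨c, hc, h⟩ := hU.exists_phase m
    refine ⟨_, ?_, by rw [h, smul_smul]⟩
    simp [hc]

lemma map_zero (hU : IsWeylLift M U) : U 0 = 1 := by
  obtain ⟨c, hc, h⟩ := hU.exists_phase 0
  have hmul := hU.map_add 0 0
  have hc0 : c ≠ 0 := by rintro rfl; simp at hc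
  rw [add_zero, h, Submodule.coe_zero, weylPlain_zero, smul_mul_smul_comm, one_mul, mul_smul,
    smul_right_inj hc0] at hmul
  rw [h, Submodule.coe_zero, weylPlain_zero, ← hmul]

lemma mul_weylPlain (hU : IsWeylLift M U) (m : M) (u : PhaseSpace d n) :
    U m * weylPlain u = (ZMod.stdAddChar (sympl m u) : ℂ) • (weylPlain u * U m) := by
  obtain ⟨c, -, h⟩ := hU.exists_phase m
  rw [h, smul_mul_assoc, weylPlain_mul_comm, mul_smul_comm, smul_comm]

lemma conjTranspose_mul_self (hU : IsWeylLift M U) (m : M) : (U m).conjTranspose * U m = 1 := by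
  obtain ⟨c, hc, h⟩ := hU.exists_phase m
  rw [h, Matrix.conjTranspose_smul, smul_mul_smul_comm, conjTranspose_weylPlain_mul_self,
    Complex.star_def, Complex.conj_mul', hc, Complex.ofReal_one, one_pow, one_smul]

lemma apply_add (hU : IsWeylLift M U) (m m' : M) (x : Hilb d n) :
    Matrix.toEuclideanLin (U (m + m')) x
      = Matrix.toEuclideanLin (U m) (Matrix.toEuclideanLin (U m') x) := by
  rw [hU.map_add, Matrix.toLpLin_mul_same, LinearMap.comp_apply]

lemma inner_map_map (hU : IsWeylLift M U) (m : M) (x y : Hilb d n) :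
    inner ℂ (Matrix.toEuclideanLin (U m) x) (Matrix.toEuclideanLin (U m) y) = inner ℂ x y := by
  rw [← LinearMap.adjoint_inner_right, ← Matrix.toEuclideanLin_conjTranspose_eq_adjoint,
    ← LinearMap.comp_apply, ← Matrix.toLpLin_mul_same, hU.conjTranspose_mul_self]
  simp

/-- Two lifts of possibly different subspaces agree up to a phase on common vectors. -/
lemma exists_phase_eq {N : Submodule (ZMod d) (PhaseSpace d n)}
    {U' : N → Matrix (Config d n) (Config d n) ℂ}
    (hU : IsWeylLift M U) (hU' : IsWeylLift N U') {m : M} {m' : N}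
    (h : (m : PhaseSpace d n) = m') : ∃ c : ℂ, ‖c‖ = 1 ∧ U m = c • U' m' := by
  obtain ⟨c, hc, h1⟩ := hU.exists_phase m
  obtain ⟨c', hc', h2⟩ := hU'.exists_phase m'
  have hc0 : c' ≠ 0 := by rintro rfl; simp at hc'
  refine ⟨c / c', by simp [hc, hc'], ?_⟩
  rw [h1, h2, h, smul_smul, div_mul_cancel₀ _ hc0]

end IsWeylLift

/-! ### The projection onto the fixed vectors of a lift -/

/-- The average `|M|⁻¹ ∑ₘ U(m)`; for a lift `U` it projects onto the common fixed vectors. -/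
noncomputable def liftAverage {M : Submodule (ZMod d) (PhaseSpace d n)} [Fintype M]
    (U : M → Matrix (Config d n) (Config d n) ℂ) : Module.End ℂ (Hilb d n) :=
  (Fintype.card M : ℂ)⁻¹ • ∑ m, Matrix.toEuclideanLin (U m)

variable {M : Submodule (ZMod d) (PhaseSpace d n)} {U : M → Matrix (Config d n) (Config d n) ℂ}
  [Fintype M]

lemma liftAverage_apply (z : Hilb d n) :
    liftAverage U z = (Fintype.card M : ℂ)⁻¹ • ∑ m, Matrix.toEuclideanLin (U m) z := by
  simp [liftAverage]

lemma liftAverage_eq_self {y : Hilb d n}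
    (hy : ∀ m, Matrix.toEuclideanLin (U m) y = y) : liftAverage U y = y := by
  have h0 : (Fintype.card M : ℂ) ≠ 0 := Nat.cast_ne_zero.2 Fintype.card_ne_zero
  rw [liftAverage_apply, Finset.sum_congr rfl fun m _ => hy m, Finset.sum_const, Finset.card_univ,
    ← Nat.cast_smul_eq_nsmul ℂ, smul_smul, inv_mul_cancel₀ h0, one_smul]

namespace IsWeylLift

lemma apply_liftAverage (hU : IsWeylLift M U) (m : M) (z : Hilb d n) :
    Matrix.toEuclideanLin (U m) (liftAverage U z) = liftAverage U z := by
  simp only [liftAverage_apply, map_smul, map_sum, ← hU.apply_add]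
  congr 1
  exact Equiv.sum_comp (Equiv.addLeft m) fun m' => Matrix.toEuclideanLin (U m') z

lemma isIdempotentElem_liftAverage (hU : IsWeylLift M U) :
    IsIdempotentElem (liftAverage U) :=
  LinearMap.ext fun z => liftAverage_eq_self fun m => hU.apply_liftAverage m z

lemma inner_liftAverage (hU : IsWeylLift M U) {y : Hilb d n}
    (hy : ∀ m, Matrix.toEuclideanLin (U m) y = y) (z : Hilb d n) :
    inner ℂ y (liftAverage U z) = inner ℂ y z := by
  have h0 : (Fintype.card M : ℂ) ≠ 0 := Nat.cast_ne_zero.2 Fintype.card_ne_zero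
  have h : ∀ m, inner ℂ y (Matrix.toEuclideanLin (U m) z) = inner ℂ y z := fun m => by
    conv_lhs => rw [← hy m]
    exact hU.inner_map_map m y z
  rw [liftAverage_apply, inner_smul_right, inner_sum, Finset.sum_congr rfl fun m _ => h m,
    Finset.sum_const, Finset.card_univ, nsmul_eq_mul, inv_mul_cancel_left₀ h0]

end IsWeylLift

end Lifts

namespace IsWeylLift

variable [Fact d.Prime] {M : Submodule (ZMod d) (PhaseSpace d n)}
  {U : M → Matrix (Config d n) (Config d n) ℂ} [Fintype M]

/-- Only the identity has nonzero trace among the Weyl operators, and `|M| = dⁿ` is the dimension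
of the Hilbert space. -/
lemma trace_liftAverage (hM : IsLagrangian M) (hU : IsWeylLift M U) :
    LinearMap.trace ℂ (Hilb d n) (liftAverage U) = 1 := by
  have htr : ∀ m, LinearMap.trace ℂ (Hilb d n) (Matrix.toEuclideanLin (U m)) = (U m).trace := by
    intro m
    rw [Matrix.toEuclideanLin, Matrix.toLpLin_eq_toLin, Matrix.trace_toLin_eq]
  have hcard : Fintype.card M = d ^ n := by rw [← Nat.card_eq_fintype_card, hM.natCard_eq]
  have hd : (d : ℂ) ≠ 0 := Nat.cast_ne_zero.2 (NeZero.ne d)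
  rw [liftAverage, LinearMap.map_smul, map_sum, Finset.sum_eq_single 0]
  · rw [htr, hU.map_zero, Matrix.trace_one, hcard, smul_eq_mul]
    simp [ZMod.card, hd]
  · intro m _ hm
    obtain ⟨c, -, h⟩ := hU.exists_phase m
    rw [htr, h, Matrix.trace_smul, weylPlain_trace (by simpa using hm), smul_zero]
  · simp

/-- The projection has trace one, hence rank one: it is `|y⟩⟨y|` for any fixed unit vector `y`. -/
lemma liftAverage_eq_inner_smul (hM : IsLagrangian M) (hU : IsWeylLift M U) {y : Hilb d n}
    (hy1 : ‖y‖ = 1) (hy : ∀ m, Matrix.toEuclideanLin (U m) y = y) (z : Hilb d n) :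
    liftAverage U z = inner ℂ y z • y := by
  have hy0 : y ≠ 0 := by rintro rfl; simp at hy1
  have hproj := LinearMap.IsIdempotentElem.isProj_range _ hU.isIdempotentElem_liftAverage
  have hrank : Module.finrank ℂ (LinearMap.range (liftAverage U)) = 1 := by
    exact_mod_cast hproj.trace.symm.trans (hU.trace_liftAverage hM)
  have hymem : y ∈ LinearMap.range (liftAverage U) := ⟨y, liftAverage_eq_self hy⟩
  obtain ⟨c, hc⟩ := (finrank_eq_one_iff_of_nonzero' (⟨y, hymem⟩ : LinearMap.range (liftAverage U))
    (by simpa using hy0)).1 hrank ⟨_, LinearMap.mem_range_self _ z⟩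
  have hc' : c • y = liftAverage U z := congrArg Subtype.val hc
  rw [← hU.inner_liftAverage hy z, ← hc', inner_smul_right, inner_self_eq_norm_sq_to_K, hy1]
  simp

end IsWeylLift

/-! ### Stabilizer states of a fixed Lagrangian subspace -/

section States

variable [NeZero d]

/-- `ψ` is fixed by some lift of `M`: it is a common eigenvector of the Weyl operators `w(m)`,
`m ∈ M`. -/
def StabilizedBy (M : Submodule (ZMod d) (PhaseSpace d n)) (ψ : Hilb d n) : Prop :=
  ∃ U, IsWeylLift M U ∧ ∀ m, Matrix.toEuclideanLin (U m) ψ = ψ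

variable {M N : Submodule (ZMod d) (PhaseSpace d n)}

lemma isWeylLift_twist_weylB (hM : IsLagrangian M) {r : ℕ} (B : Module.Basis (Fin r) (ZMod d) M)
    (v : PhaseSpace d n) : IsWeylLift M fun m => omega d ^ (sympl v m).val • weylB B m := by
  simpa only [omega_pow_val] using (isWeylLift_weylB hM B).twist v

lemma IsStabilizerState.exists_stabilizedBy {ψ : Hilb d n} (h : IsStabilizerState ψ) :
    ∃ M : Submodule (ZMod d) (PhaseSpace d n), IsLagrangian M ∧ StabilizedBy M ψ := by
  obtain ⟨-, M, hM, B, v, hψ⟩ := h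
  exact ⟨M, hM, _, isWeylLift_twist_weylB hM B v, fun m => by
    rw [map_smul, LinearMap.smul_apply, hψ m]⟩

lemma StabilizedBy.smul {ψ : Hilb d n} (h : StabilizedBy M ψ) (c : ℂ) : StabilizedBy M (c • ψ) := by
  obtain ⟨U, hU, hψ⟩ := h
  exact ⟨U, hU, fun m => by rw [map_smul, hψ]⟩

/-- Some lift element moves `w(u)` to a nontrivial multiple of itself and fixes `ψ`. -/
lemma StabilizedBy.inner_weylPlain_eq_zero {ψ : Hilb d n} (h : StabilizedBy M ψ)
    (hM : IsLagrangian M) {u : PhaseSpace d n} (hu : u ∉ M) :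
    inner ℂ ψ (Matrix.toEuclideanLin (weylPlain u) ψ) = 0 := by
  obtain ⟨U, hU, hψ⟩ := h
  obtain ⟨m, hm, hum⟩ : ∃ m ∈ M, sympl u m ≠ 0 := by
    by_contra! h
    exact hu ((hM u).2 h)
  have hchar : (ZMod.stdAddChar (sympl m u) : ℂ) ≠ 1 := by
    rw [← AddChar.map_zero_eq_one (ZMod.stdAddChar (N := d)), ZMod.injective_stdAddChar.ne_iff,
      sympl_swap, neg_ne_zero]
    exact hum
  have hcomm : Matrix.toEuclideanLin (U ⟨m, hm⟩) (Matrix.toEuclideanLin (weylPlain u) ψ)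
      = (ZMod.stdAddChar (sympl m u) : ℂ) • Matrix.toEuclideanLin (weylPlain u) ψ := by
    rw [← LinearMap.comp_apply, ← Matrix.toLpLin_mul_same, hU.mul_weylPlain, map_smul,
      LinearMap.smul_apply, Matrix.toLpLin_mul_same, LinearMap.comp_apply, hψ]
  have h := hU.inner_map_map ⟨m, hm⟩ ψ (Matrix.toEuclideanLin (weylPlain u) ψ)
  rw [hψ, hcomm, inner_smul_right] at h
  by_contra h0
  exact hchar (mul_right_cancel₀ h0 (h.trans (one_mul _).symm))

/-- A stabilizer state determines its Lagrangian subspace `{m | ψ is an eigenvector of w(m)}`. -/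
lemma StabilizedBy.unique {ψ : Hilb d n} (hψ : ψ ≠ 0) (hM : IsLagrangian M) (hN : IsLagrangian N)
    (h : StabilizedBy M ψ) (h' : StabilizedBy N ψ) : M = N := by
  refine (hN.eq_of_le hM fun m hm => ?_).symm
  by_contra hmM
  obtain ⟨U, hU, hUψ⟩ := h'
  obtain ⟨c, -, hc⟩ := hU.exists_phase ⟨m, hm⟩
  have h1 : inner ℂ ψ (Matrix.toEuclideanLin (U ⟨m, hm⟩) ψ) = 0 := by
    rw [hc, map_smul, LinearMap.smul_apply, inner_smul_right, h.inner_weylPlain_eq_zero hM hmM,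
      mul_zero]
  rw [hUψ] at h1
  exact hψ (inner_self_eq_zero.1 h1)

end States

section Prime

variable [Fact d.Prime] {M N : Submodule (ZMod d) (PhaseSpace d n)}

/-- Two stabilizer states of `M` either have the same eigenvalues, and then agree up to a phase
because the joint eigenspace is one-dimensional, or they are orthogonal. -/
lemma StabilizedBy.inner_eq_zero_or_eq_smul (hM : IsLagrangian M) {x y : Hilb d n}
    (hx : StabilizedBy M x) (hy : StabilizedBy M y) (hx1 : ‖x‖ = 1) (hy1 : ‖y‖ = 1) :
    inner ℂ x y = (0 : ℂ) ∨ ∃ c : ℂ, ‖c‖ = 1 ∧ y = c • x := by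
  obtain ⟨U, hU, hUx⟩ := hx
  obtain ⟨U', hU', hUy⟩ := hy
  by_cases hfix : ∀ m, Matrix.toEuclideanLin (U m) y = y
  · right
    let := Fintype.ofFinite M
    have hyx : y = inner ℂ x y • x := by
      rw [← hU.liftAverage_eq_inner_smul hM hx1 hUx y, liftAverage_eq_self hfix]
    refine ⟨_, ?_, hyx⟩
    have h := congrArg norm hyx
    rwa [norm_smul, hx1, hy1, mul_one, eq_comm] at h
  · left
    push Not at hfix
    obtain ⟨m, hm⟩ := hfix
    obtain ⟨c, -, hc⟩ := hU.exists_phase_eq hU' (m := m) (m' := m) rfl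
    have hmy : Matrix.toEuclideanLin (U m) y = c • y := by
      rw [hc, map_smul, LinearMap.smul_apply, hUy]
    have h := hU.inner_map_map m x y
    rw [hUx, hmy, inner_smul_right] at h
    by_contra h0
    have hc1 : c = 1 := mul_right_cancel₀ h0 (h.trans (one_mul _).symm)
    exact hm (by rw [hmy, hc1, one_smul])

/-- Orthogonality of the characters `v ↦ ω^{[v, m]}` of the phase space. -/
lemma sum_stdAddChar_sympl [Fintype (PhaseSpace d n)] (m : PhaseSpace d n) :
    ∑ v, (ZMod.stdAddChar (sympl v m) : ℂ)
      = if m = 0 then (Fintype.card (PhaseSpace d n) : ℂ) else 0 := by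
  split_ifs with hm
  · simp [hm]
  let χ : AddChar (PhaseSpace d n) ℂ :=
    ZMod.stdAddChar.compAddMonoidHom ((symplForm d n).flip m).toAddMonoidHom
  refine AddChar.sum_eq_zero_iff_ne_zero (ψ := χ).2 fun h => hm ?_
  refine eq_zero_of_forall_sympl_eq_zero fun u => ZMod.injective_stdAddChar ?_
  rw [AddChar.map_zero_eq_one]
  exact DFunLike.congr_fun h u

/-- The stabilizer states of `M` are complete: the projections onto the joint eigenspaces for the
lifts `ω^{[v, m]} w_B(m)` add up, over all `v`, to a nonzero multiple of the identity. -/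
lemma eq_zero_of_forall_inner_stabilizerState_eq_zero (hM : IsLagrangian M) {z : Hilb d n}
    (hz : ∀ ψ, IsStabilizerState ψ → StabilizedBy M ψ → inner ℂ ψ z = (0 : ℂ)) : z = 0 := by
  let := Fintype.ofFinite M
  let B := Module.finBasis (ZMod d) M
  let U : PhaseSpace d n → M → Matrix (Config d n) (Config d n) ℂ :=
    fun v m => omega d ^ (sympl v m).val • weylB B m
  have hU : ∀ v, IsWeylLift M (U v) := isWeylLift_twist_weylB hM B
  have hzero : ∀ v, liftAverage (U v) z = 0 := by
    intro v
    set w := liftAverage (U v) z with hw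
    have hfix : ∀ m, Matrix.toEuclideanLin (U v m) w = w := fun m => (hU v).apply_liftAverage m z
    by_contra hw0
    have hfix' : ∀ m, Matrix.toEuclideanLin (U v m) ((‖w‖⁻¹ : ℂ) • w) = (‖w‖⁻¹ : ℂ) • w :=
      fun m => by rw [map_smul, hfix]
    have hstab : IsStabilizerState ((‖w‖⁻¹ : ℂ) • w) := by
      refine ⟨norm_smul_inv_norm hw0, M, hM, B, v, fun m => ?_⟩
      rw [← LinearMap.smul_apply, ← map_smul]
      exact hfix' m
    have h := hz _ hstab ⟨_, hU v, hfix'⟩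
    rw [← (hU v).inner_liftAverage hfix', ← hw, inner_smul_left, mul_eq_zero] at h
    rcases h with h | h
    · simp [hw0] at h
    · exact hw0 (inner_self_eq_zero.1 h)
  have hd : (Fintype.card M : ℂ) ≠ 0 := Nat.cast_ne_zero.2 Fintype.card_ne_zero
  have hV : (Fintype.card (PhaseSpace d n) : ℂ) ≠ 0 := Nat.cast_ne_zero.2 Fintype.card_ne_zero
  have hsum : ∑ v, liftAverage (U v) z
      = ((Fintype.card M : ℂ)⁻¹ * Fintype.card (PhaseSpace d n)) • z := by
    simp only [liftAverage_apply, ← Finset.smul_sum, mul_smul]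
    congr 1
    rw [Finset.sum_comm]
    simp only [U, map_smul, LinearMap.smul_apply, ← Finset.sum_smul, omega_pow_val,
      sum_stdAddChar_sympl]
    rw [Finset.sum_eq_single 0]
    · simp [(isWeylLift_weylB hM B).map_zero]
    · intro m _ hm
      rw [if_neg (by simpa using hm), zero_smul]
    · simp
  rw [Finset.sum_congr rfl fun v _ => hzero v, Finset.sum_const_zero, eq_comm, smul_eq_zero] at hsum
  exact hsum.resolve_left (mul_ne_zero (inv_ne_zero hd) hV)

/-- `|⟨x, y⟩|²` is the average of `⟨x, U(m) x⟩` over the lift `U` of `N` fixing `y`. The terms with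
`m ∉ M` vanish and the others form a character of `M ⊓ N`. -/
lemma StabilizedBy.norm_inner_sq (hM : IsLagrangian M) (hN : IsLagrangian N) {x y : Hilb d n}
    (hx : StabilizedBy M x) (hy : StabilizedBy N y) (hx1 : ‖x‖ = 1) (hy1 : ‖y‖ = 1) :
    ‖inner ℂ x y‖ ^ 2 = 0 ∨ ‖inner ℂ x y‖ ^ 2
      = (d : ℝ) ^ Module.finrank (ZMod d) (M ⊓ N : Submodule (ZMod d) (PhaseSpace d n)) / d ^ n := by
  classical
  let := Fintype.ofFinite N
  obtain ⟨U, hU, hUy⟩ := hy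
  set g : N → ℂ := fun m => inner ℂ x (Matrix.toEuclideanLin (U m) x) with hg
  have hcard : Fintype.card N = d ^ n := by rw [← Nat.card_eq_fintype_card, hN.natCard_eq]
  have havg : ((‖inner ℂ x y‖ ^ 2 : ℝ) : ℂ) = (∑ m, g m) / d ^ n := by
    have h := congrArg (inner ℂ x) (hU.liftAverage_eq_inner_smul hN hy1 hUy x)
    rw [liftAverage_apply, inner_smul_right, inner_sum, inner_smul_right, hcard] at h
    rw [← inner_conj_symm y x, Complex.conj_mul'] at h
    push_cast at h ⊢
    rw [← h, div_eq_inv_mul]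
  have hg0 : ∀ m : N, (m : PhaseSpace d n) ∉ M → g m = 0 := by
    intro m hm
    obtain ⟨c, -, hc⟩ := hU.exists_phase m
    simp only [hg, hc, map_smul, LinearMap.smul_apply, inner_smul_right,
      hx.inner_weylPlain_eq_zero hM hm, mul_zero]
  have hgsmul : ∀ m : N, (m : PhaseSpace d n) ∈ M → Matrix.toEuclideanLin (U m) x = g m • x := by
    intro m hm
    obtain ⟨U', hU', hUx⟩ := hx
    obtain ⟨c, -, hc⟩ := hU.exists_phase_eq hU' (m := m) (m' := ⟨m, hm⟩) rfl
    have h : Matrix.toEuclideanLin (U m) x = c • x := by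
      rw [hc, map_smul, LinearMap.smul_apply, hUx]
    simp [hg, h, inner_self_eq_norm_sq_to_K, hx1]
  by_cases hone : ∀ m : N, (m : PhaseSpace d n) ∈ M → g m = 1
  · right
    have hS : ∑ m, g m
        = d ^ (Module.finrank (ZMod d) (M ⊓ N : Submodule (ZMod d) (PhaseSpace d n))) := by
      have h1 : ∀ m : N, g m = if (m : PhaseSpace d n) ∈ M then 1 else 0 := by
        intro m
        split_ifs with hm
        · exact hone m hm
        · exact hg0 m hm
      have h2 : Nat.card {m : N // (m : PhaseSpace d n) ∈ M}
          = Nat.card (M ⊓ N : Submodule (ZMod d) (PhaseSpace d n)) :=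
        Nat.card_congr ((Equiv.subtypeSubtypeEquivSubtypeInter _ _).trans
          (Equiv.subtypeEquivRight fun v => and_comm))
      rw [Module.natCard_eq_pow_finrank (K := ZMod d)
        (V := (M ⊓ N : Submodule (ZMod d) (PhaseSpace d n))), Nat.card_zmod] at h2
      rw [Finset.sum_congr rfl fun m _ => h1 m, Finset.sum_boole, ← Fintype.card_subtype,
        ← Nat.card_eq_fintype_card, h2]
      push_cast
      rfl
    rw [hS] at havg
    apply Complex.ofReal_injective
    rw [havg]
    push_cast
    rfl
  · left
    push Not at hone
    obtain ⟨m₀, hm₀, hne⟩ := hone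
    have hS : g m₀ * ∑ m, g m = ∑ m, g m := by
      rw [Finset.mul_sum, ← Equiv.sum_comp (Equiv.addRight m₀) g]
      refine Finset.sum_congr rfl fun m _ => ?_
      have h : g (m + m₀) = inner ℂ x (g m₀ • Matrix.toEuclideanLin (U m) x) := by
        rw [← map_smul, ← hgsmul m₀ hm₀, ← hU.apply_add]
      rw [Equiv.coe_addRight, h, inner_smul_right]
    have hS0 : ∑ m, g m = 0 := by
      by_contra h0
      exact hne (mul_right_cancel₀ h0 (hS.trans (one_mul _).symm))
    rw [hS0, zero_div] at havg
    exact_mod_cast havg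

end Prime

/-! ### Frame potentials -/

lemma integral_uniformOn {Ω : Type*} [MeasurableSpace Ω] [MeasurableSingletonClass Ω]
    (s : Finset Ω) (f : Ω → ℝ) :
    ∫ x, f x ∂(uniformOn (s : Set Ω)) = (s.card : ℝ)⁻¹ * ∑ x ∈ s, f x := by
  have hf : IntegrableOn f s Measure.count := by
    rw [← Set.biUnion_of_singleton (s : Set Ω), integrableOn_finite_biUnion s.finite_toSet]
    exact fun x _ => integrableOn_singleton (hx := by simp)
  rw [uniformOn, ProbabilityTheory.cond, integral_smul_measure, setIntegral_finset _ hf,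
    Measure.count_apply_finset]
  simp [Measure.real]

section

variable [Fact d.Prime] {X : Set (Hilb d n)} {M : Submodule (ZMod d) (PhaseSpace d n)}

lemma IsStabs.orthonormal (hX : IsStabs d n X) (hM : IsLagrangian M) :
    Orthonormal ℂ (Subtype.val : {y // y ∈ X ∧ StabilizedBy M y} → Hilb d n) := by
  refine ⟨fun y => (hX.isStabilizerState y y.2.1).1, fun x y hxy => ?_⟩
  have hy := hX.isStabilizerState y y.2.1
  refine (StabilizedBy.inner_eq_zero_or_eq_smul hM x.2.2 y.2.2
    (hX.isStabilizerState x x.2.1).1 hy.1).resolve_right fun hc => hxy (Subtype.ext ?_)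
  exact (hX.existsUnique_phase y hy).unique ⟨x.2.1, hc⟩ ⟨y.2.1, 1, by simp, by simp⟩

lemma IsStabs.span_eq_top (hX : IsStabs d n X) (hM : IsLagrangian M) :
    Submodule.span ℂ (Set.range (Subtype.val : {y // y ∈ X ∧ StabilizedBy M y} → Hilb d n))
      = ⊤ := by
  rw [← Submodule.orthogonal_eq_bot_iff, Submodule.eq_bot_iff]
  refine fun z hz => eq_zero_of_forall_inner_stabilizerState_eq_zero hM fun ψ hψ hψM => ?_
  obtain ⟨x, ⟨hxX, c, hc, rfl⟩, -⟩ := hX.existsUnique_phase ψ hψ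
  have hc0 : c ≠ 0 := by rintro rfl; simp at hc
  have hxM : StabilizedBy M x := by simpa [smul_smul, hc0] using hψM.smul c⁻¹
  rw [inner_smul_left, (Submodule.mem_orthogonal _ z).1 hz x
    (Submodule.subset_span ⟨⟨x, hxX, hxM⟩, rfl⟩), mul_zero]

lemma IsStabs.finite_stabilizedBy (hX : IsStabs d n X) (hM : IsLagrangian M) :
    {y | y ∈ X ∧ StabilizedBy M y}.Finite :=
  (hX.orthonormal hM).linearIndependent.finite

lemma IsStabs.finite (hX : IsStabs d n X) : X.Finite := by
  have h : (⋃ M ∈ {M : Submodule (ZMod d) (PhaseSpace d n) | IsLagrangian M},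
      {y | y ∈ X ∧ StabilizedBy M y}).Finite :=
    (Set.toFinite _).biUnion fun M hM => hX.finite_stabilizedBy hM
  refine h.subset fun y hy => ?_
  obtain ⟨M, hM, hyM⟩ := (hX.isStabilizerState y hy).exists_stabilizedBy
  exact Set.mem_biUnion hM ⟨hy, hyM⟩

lemma IsStabs.nonempty (hX : IsStabs d n X) : X.Nonempty := by
  by_contra! hempty
  have h : (EuclideanSpace.single 0 1 : Hilb d n) = 0 := by
    refine eq_zero_of_forall_inner_stabilizerState_eq_zero isLagrangian_prod_top_bot
      fun ψ hψ _ => ?_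
    obtain ⟨x, ⟨hxX, -⟩, -⟩ := hX.existsUnique_phase ψ hψ
    simp [hempty] at hxX
  simpa using congrArg norm h

/-- Parseval's identity for the orthonormal basis of stabilizer states of `M`. -/
lemma IsStabs.sum_norm_inner_sq (hX : IsStabs d n X) (hM : IsLagrangian M) {s : Finset (Hilb d n)}
    (hs : ∀ y, y ∈ s ↔ y ∈ X ∧ StabilizedBy M y) (x : Hilb d n) :
    ∑ y ∈ s, ‖inner ℂ x y‖ ^ 2 = ‖x‖ ^ 2 := by
  let hfin : Fintype {y // y ∈ X ∧ StabilizedBy M y} := (hX.finite_stabilizedBy hM).fintype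
  let b : OrthonormalBasis {y // y ∈ X ∧ StabilizedBy M y} ℂ (Hilb d n) :=
    OrthonormalBasis.mk (hX.orthonormal hM) (hX.span_eq_top hM).ge
  rw [← b.sum_sq_norm_inner_left x, Finset.sum_subtype (F := hfin) s hs]
  simp [b]

/-- The overlaps of `x` with the stabilizer states of `N` are `0` or `d ^ (k - n)`, with
`k = dim (M ⊓ N)`, and add up to one. Since `t ≥ 1`, the `t`-th power of an overlap is
`d ^ ((k - n) (t - 1))` times the overlap also where the latter vanishes. -/
lemma IsStabs.sum_norm_inner_pow (hX : IsStabs d n X) {N : Submodule (ZMod d) (PhaseSpace d n)}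
    (hM : IsLagrangian M) (hN : IsLagrangian N) {s : Finset (Hilb d n)}
    (hs : ∀ y, y ∈ s ↔ y ∈ X ∧ StabilizedBy N y) {x : Hilb d n} (hx : StabilizedBy M x)
    (hx1 : ‖x‖ = 1) {t : ℕ} (ht : 1 ≤ t) :
    ∑ y ∈ s, ‖inner ℂ x y‖ ^ (2 * t)
      = (d : ℝ) ^ ((1 - (t : ℤ)) * ((n : ℤ) - (Module.finrank (ZMod d)
          (M ⊓ N : Submodule (ZMod d) (PhaseSpace d n)) : ℤ))) := by
  set k := Module.finrank (ZMod d) (M ⊓ N : Submodule (ZMod d) (PhaseSpace d n)) with hk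
  have hd : (d : ℝ) ≠ 0 := Nat.cast_ne_zero.2 (NeZero.ne d)
  have hterm : ∀ y ∈ s, ‖inner ℂ x y‖ ^ (2 * t)
      = (d : ℝ) ^ ((1 - (t : ℤ)) * ((n : ℤ) - k)) * ‖inner ℂ x y‖ ^ 2 := by
    intro y hy
    obtain ⟨hyX, hyN⟩ := (hs y).1 hy
    rw [pow_mul]
    rcases hx.norm_inner_sq hM hN hyN hx1 (hX.isStabilizerState y hyX).1 with h | h
    · rw [h, zero_pow (by omega), mul_zero]
    · rw [h, ← hk, ← zpow_natCast (d : ℝ) k, ← zpow_natCast (d : ℝ) n, ← zpow_sub₀ hd,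
        ← zpow_natCast, ← zpow_mul, ← zpow_add₀ hd]
      congr 1
      ring
  rw [Finset.sum_congr rfl hterm, ← Finset.mul_sum, hX.sum_norm_inner_sq hN hs, hx1, one_pow,
    mul_one]

/-- Sorting the Lagrangian subspaces by the dimension of their intersection with `M`. -/
lemma sum_isLagrangian_eq_sum_kappa (hM : IsLagrangian M)
    {L : Finset (Submodule (ZMod d) (PhaseSpace d n))} (hL : ∀ N, N ∈ L ↔ IsLagrangian N)
    (f : ℕ → ℝ) :
    ∑ N ∈ L, f (Module.finrank (ZMod d) (M ⊓ N : Submodule (ZMod d) (PhaseSpace d n)))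
      = ∑ k ∈ Finset.range (n + 1), (kappa M k : ℝ) * f k := by
  classical
  have hmaps : ∀ N ∈ L, Module.finrank (ZMod d) (M ⊓ N : Submodule (ZMod d) (PhaseSpace d n))
      ∈ Finset.range (n + 1) := by
    intro N _
    rw [Finset.mem_range, Nat.lt_succ_iff]
    exact (Submodule.finrank_mono inf_le_left).trans_eq hM.finrank_eq
  rw [← Finset.sum_fiberwise_of_maps_to hmaps]
  refine Finset.sum_congr rfl fun k _ => ?_
  rw [Finset.sum_congr rfl fun N hN => congrArg f (Finset.mem_filter.1 hN).2, Finset.sum_const,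
    nsmul_eq_mul, kappa, ← Set.ncard_coe_finset]
  congr 3
  ext N
  simp [hL]

end

end StabFrame

theorem mainTheorem6 (d n t : ℕ) [Fact d.Prime] (ht : 1 ≤ t)
    (X : Set (StabFrame.Hilb d n)) (hX : StabFrame.IsStabs d n X) :
    X.Finite ∧ X.Nonempty ∧
      ∀ M : Submodule (ZMod d) (StabFrame.PhaseSpace d n), StabFrame.IsLagrangian M →
        StabFrame.framePotential t (ProbabilityTheory.uniformOn X) =
          1 / (X.ncard : ℝ) * ∑ k ∈ Finset.range (n + 1),
            (StabFrame.kappa M k : ℝ) * (d : ℝ) ^ ((1 - (t : ℤ)) * ((n : ℤ) - (k : ℤ))) := by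
  classical
  refine ⟨hX.finite, hX.nonempty, fun M hM => ?_⟩
  obtain ⟨F, rfl⟩ := hX.finite.exists_finset_coe
  have hF : (F.card : ℝ) ≠ 0 := by
    rw [Nat.cast_ne_zero, Finset.card_ne_zero, ← Finset.coe_nonempty]
    exact hX.nonempty
  set S := ∑ k ∈ Finset.range (n + 1),
    (StabFrame.kappa M k : ℝ) * (d : ℝ) ^ ((1 - (t : ℤ)) * ((n : ℤ) - (k : ℤ))) with hS
  have hstab := hX.isStabilizerState
  choose! L hL hLstab using fun y hy => (hstab y hy).exists_stabilizedBy
  have hne : ∀ y ∈ F, y ≠ 0 := by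
    rintro _ hy rfl
    simpa using (hstab 0 hy).1
  let lag := (Set.toFinite {N : Submodule (ZMod d) (StabFrame.PhaseSpace d n) |
    StabFrame.IsLagrangian N}).toFinset
  have hlag : ∀ N, N ∈ lag ↔ StabFrame.IsLagrangian N := fun N => by simp [lag]
  have hrow : ∀ x ∈ F, ∑ y ∈ F, ‖inner ℂ x y‖ ^ (2 * t) = S := by
    intro x hx
    rw [← Finset.sum_fiberwise_of_maps_to (fun y hy => (hlag _).2 (hL y hy)), hS]
    simp_rw [StabFrame.kappa_eq_kappa hM (hL x hx)]
    rw [← StabFrame.sum_isLagrangian_eq_sum_kappa (hL x hx) hlag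
      (fun k => (d : ℝ) ^ ((1 - (t : ℤ)) * ((n : ℤ) - (k : ℤ))))]
    refine Finset.sum_congr rfl fun N hN => ?_
    have hN' := (hlag N).1 hN
    refine hX.sum_norm_inner_pow (hL x hx) hN' (fun y => ?_) (hLstab x hx) (hstab x hx).1 ht
    rw [Finset.mem_filter, Finset.mem_coe]
    refine and_congr_right fun hy => ⟨fun h => h ▸ hLstab y hy, fun h => ?_⟩
    exact (hLstab y hy).unique (hne y hy) (hL y hy) hN' h
  simp only [StabFrame.framePotential, StabFrame.integral_uniformOn]
  rw [← Finset.mul_sum, Finset.sum_congr rfl hrow, Finset.sum_const, nsmul_eq_mul,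
    Set.ncard_coe_finset]
  field_simp
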